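/- Let $\xi$ and $z$ be two commuting free variables. On the vector space $\mathbb{C}[\xi,z]$ define the product $$f * g := \mu\bigl(e^{-\Omega}(f\otimes g)\bigr)=\sum_{k\ge 0}\frac{(-1)^k}{k!}\,\mu\bigl(\Omega^k(f\otimes g)\bigr),\qquad \Omega:=\partial_z\otimes\partial_\xi+\partial_\xi\otimes\partial_z,$$ where $\mu:\mathbb{C}[\xi,z]\otimes_{\mathbb C}\mathbb{C}[\xi,z]\to\mathbb{C}[\xi,z]$ is the usual multiplication of polynomials (the sum is finite, since $\Omega$ is locally nilpotent). **Theorem 5.6.** For every integer $m\ge 2$, the polynomial $\xi^m * z^m$ has rational coefficients and is irreducible in the polynomial ring $\mathbb{Q}[\xi,z]$. -/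

import Mathlib

open MvPolynomial
open scoped TensorProduct Nat

noncomputable section

/-- The space `ℂ[ξ, z]` of polynomials in the `2n` variables `ξ₁, …, ξₙ` (left summand) and
`z₁, …, zₙ` (right summand). -/
abbrev XiZPoly (n : ℕ) : Type := MvPolynomial (Fin n ⊕ Fin n) ℂ

/-- The operator `∂ᵢ`, the partial derivative with respect to `zᵢ`. -/
def dZ {n : ℕ} (i : Fin n) : XiZPoly n →ₗ[ℂ] XiZPoly n :=
  (pderiv (Sum.inr i)).toLinearMap

/-- The operator `δᵢ`, the partial derivative with respect to `ξᵢ`. -/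
def dXi {n : ℕ} (i : Fin n) : XiZPoly n →ₗ[ℂ] XiZPoly n :=
  (pderiv (Sum.inl i)).toLinearMap

/-- The operator `Ω = ∑ᵢ (∂ᵢ ⊗ δᵢ + δᵢ ⊗ ∂ᵢ)` on `ℂ[ξ, z] ⊗ ℂ[ξ, z]`. -/
def starOmega (n : ℕ) : (XiZPoly n ⊗[ℂ] XiZPoly n) →ₗ[ℂ] (XiZPoly n ⊗[ℂ] XiZPoly n) :=
  ∑ i : Fin n, (TensorProduct.map (dZ i) (dXi i) + TensorProduct.map (dXi i) (dZ i))

/-- The exponential `e^T u = ∑ₖ T^k u / k!` of a locally nilpotent endomorphism `T` of a complex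
vector space. For each `u` only finitely many terms are nonzero. -/
def locNilExp {V : Type*} [AddCommGroup V] [Module ℂ V] (T : V →ₗ[ℂ] V) (u : V) : V :=
  ∑ᶠ k : ℕ, ((k ! : ℂ)⁻¹) • (T ^ k) u

/-- The product `f ∗ₜ g = μ (e^{-tΩ} (f ⊗ g))` on `ℂ[ξ, z]`, where `μ` is the ordinary
multiplication of polynomials. -/
def starProd {n : ℕ} (t : ℂ) (f g : XiZPoly n) : XiZPoly n :=
  LinearMap.mul' ℂ (XiZPoly n) (locNilExp ((-t) • starOmega n) (f ⊗ₜ[ℂ] g))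

/-- A partial derivative of a nonconstant polynomial has smaller total degree, or vanishes. -/
theorem pderiv_eq_zero_or_totalDegree_lt {σ : Type*} (s : σ) (d : ℕ) (f : MvPolynomial σ ℂ)
    (hf : f.totalDegree < d + 1) : pderiv s f = 0 ∨ (pderiv s f).totalDegree < d := by
  classical
  have key : ∀ m ∈ (pderiv s f).support, (m.sum fun _ e => e) + 1 ≤ f.totalDegree := by
    intro m hm
    rw [mem_support_iff, coeff_pderiv] at hm
    have h1 : m + Finsupp.single s 1 ∈ f.support := by
      rw [mem_support_iff]
      exact fun h => hm (by rw [h, zero_mul])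
    have h2 := le_totalDegree h1
    rwa [Finsupp.sum_add_index' (fun _ => rfl) (fun _ _ _ => rfl),
      Finsupp.sum_single_index rfl] at h2
  by_cases h0 : pderiv s f = 0
  · exact Or.inl h0
  · right
    obtain ⟨m, hm⟩ := support_nonempty.mpr h0
    have := key m hm
    rw [totalDegree, Finset.sup_lt_iff (by simp only [Nat.bot_eq_zero]; omega)]
    intro m' hm'
    have := key m' hm'
    omega

/-- Powers of `Ω` annihilate `f ⊗ g` as soon as the exponent exceeds the total degree of `f`. -/
theorem starOmega_pow_tmul {n : ℕ} (k : ℕ) (f g : XiZPoly n) (hk : f.totalDegree < k) :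
    (starOmega n ^ k) (f ⊗ₜ[ℂ] g) = 0 := by
  induction k generalizing f g with
  | zero => omega
  | succ k ih =>
    have key : ∀ (s : Fin n ⊕ Fin n) (h : XiZPoly n),
        (starOmega n ^ k) (pderiv s f ⊗ₜ[ℂ] h) = 0 := by
      intro s h
      rcases pderiv_eq_zero_or_totalDegree_lt s k f hk with h0 | h0
      · simp [h0]
      · exact ih _ _ h0
    rw [pow_succ, Module.End.mul_apply]
    conv_lhs => rw [starOmega.eq_1]
    simp only [LinearMap.sum_apply, LinearMap.add_apply, TensorProduct.map_tmul, map_sum, map_add]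
    refine Finset.sum_eq_zero fun i _ => ?_
    rw [← starOmega.eq_1]
    have h1 := key (Sum.inr i) (dXi i g)
    have h2 := key (Sum.inl i) (dZ i g)
    simp only [dZ, dXi, Derivation.coeFn_coe] at *
    rw [h1, h2, add_zero]

/-- `tΩ` is locally nilpotent, so the sum that defines its exponential is a finite one. -/
theorem starOmega_locallyNilpotent {n : ℕ} (t : ℂ) (u : XiZPoly n ⊗[ℂ] XiZPoly n) :
    ∃ N : ℕ, ∀ k, N ≤ k → ((t • starOmega n) ^ k) u = 0 := by
  induction u using TensorProduct.induction_on with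
  | zero => exact ⟨0, fun k _ => map_zero _⟩
  | tmul f g =>
    refine ⟨f.totalDegree + 1, fun k hk => ?_⟩
    rw [smul_pow, LinearMap.smul_apply, starOmega_pow_tmul k f g (by omega), smul_zero]
  | add u v hu hv =>
    obtain ⟨N, hN⟩ := hu
    obtain ⟨M, hM⟩ := hv
    refine ⟨max N M, fun k hk => ?_⟩
    rw [map_add, hN k (le_trans (le_max_left _ _) hk), hM k (le_trans (le_max_right _ _) hk),
      add_zero]

end

/-! On `ξ^m ⊗ z^m` only `∂_ξ ⊗ ∂_z` survives, so `ξ^m * z^m = F(ξz)`, where `F` has coefficients `±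
(m choose j) m!/j!` and is a Laguerre polynomial made monic. The heart is Schur's theorem that `F`
is irreducible over `ℚ`, proved with `p`-adic Newton polygons.

The polygon of `F` at `p` is that of the truncated exponential series. Its vertices are the
truncations `⌊m/p^n⌋ p^n`, and the side between those for `n + 1` and `n` has slope `(p^n - 1)/(p^n
(p - 1))` up to sign (`isDominant_monicLaguerre`). In lowest terms `p^n` divides the denominator, so
any factor of `F` over `ℚ` uses a multiple of `p^n` of the length of that side
(`IsDominant.dvd_sub`). If `p^r ∣ m`, the sides with `n < r` are degenerate, hence `p^r` divides the
degree of every factor. Over all prime powers, `m` divides that degree, so it is `0` or `m`.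

For `F(ξz)` in `ℚ[z][ξ]`, putting `z = 1` reduces to `F`: one factor has `ξ`-degree `0`, and it is a
unit because the constant coefficient is. -/

/-! ### Newton polygons through dominant terms of Gauss norms. -/

/-- The term `g.coeff a * X ^ a` is dominant in `g` for the Gauss norm of radius `ρ`, and it is
strictly larger than the terms of index `i` with `σ * i < σ * a`. For `σ = 1` and `σ = -1` the index
`a` is the left, resp. right, end of a side of the Newton polygon of `g`. -/
def IsDominant {K Γ : Type*} [Field K] [LinearOrderedCommGroupWithZero Γ] (v : Valuation K Γ)
    (ρ : Γ) (σ : ℤ) (g : Polynomial K) (a : ℕ) : Prop :=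
  g.coeff a ≠ 0 ∧ ∀ i, v (g.coeff i) * ρ ^ i ≤ v (g.coeff a) * ρ ^ a ∧
    (σ * i < σ * a → v (g.coeff i) * ρ ^ i < v (g.coeff a) * ρ ^ a)

namespace IsDominant

variable {K Γ : Type*} [Field K] [LinearOrderedCommGroupWithZero Γ] {v : Valuation K Γ}
  {ρ ρ' : Γ} {σ σ' : ℤ} {g h : Polynomial K} {a a' b : ℕ}

theorem pos (hρ : 0 < ρ) (hg : IsDominant v ρ σ g a) : 0 < v (g.coeff a) * ρ ^ a :=
  mul_pos (zero_lt_iff.2 (v.ne_zero_iff.2 hg.1)) (pow_pos hρ a)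

theorem unique (hσ : σ ≠ 0) (hg : IsDominant v ρ σ g a) (hg' : IsDominant v ρ σ g a') :
    a = a' := by
  rcases lt_trichotomy (σ * a) (σ * a') with h | h | h
  · exact absurd ((hg'.2 a).2 h) (not_lt.2 (hg.2 a').1)
  · exact_mod_cast mul_left_cancel₀ hσ h
  · exact absurd ((hg.2 a').2 h) (not_lt.2 (hg'.2 a).1)

theorem weight_eq (hg : IsDominant v ρ σ g a) (hg' : IsDominant v ρ σ' g a') :
    v (g.coeff a) * ρ ^ a = v (g.coeff a') * ρ ^ a' :=
  le_antisymm (hg'.2 a).1 (hg.2 a').1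

theorem exists_of_ne_zero (v : Valuation K Γ) (hρ : 0 < ρ) (σ : ℤ) (hg : g ≠ 0) :
    ∃ a, IsDominant v ρ σ g a := by
  classical
  obtain ⟨b, hb, hmax⟩ := g.support.exists_max_image (fun i => v (g.coeff i) * ρ ^ i)
    (Polynomial.support_nonempty.2 hg)
  -- Among the indices of maximal weight, the least value of `σ * i` picks the required end of the
  -- side.
  obtain ⟨a, ha, hmin⟩ := (g.support.filter
    (fun i => v (g.coeff i) * ρ ^ i = v (g.coeff b) * ρ ^ b)).exists_min_image
    (fun i => σ * (i : ℤ)) ⟨b, by simp [Polynomial.mem_support_iff.1 hb]⟩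
  rw [Finset.mem_filter, Polynomial.mem_support_iff] at ha
  have hle : ∀ i, v (g.coeff i) * ρ ^ i ≤ v (g.coeff a) * ρ ^ a := by
    intro i
    rw [ha.2]
    by_cases hi : g.coeff i = 0
    · simp [hi]
    · exact hmax i (Polynomial.mem_support_iff.2 hi)
  refine ⟨a, ha.1, fun i => ⟨hle i, fun hlt => (hle i).lt_of_ne fun heq => ?_⟩⟩
  have hpos : 0 < v (g.coeff a) * ρ ^ a :=
    mul_pos (zero_lt_iff.2 (v.ne_zero_iff.2 ha.1)) (pow_pos hρ a)
  have hi : g.coeff i ≠ 0 := by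
    intro h0
    rw [← heq, h0] at hpos
    simp at hpos
  exact absurd (hmin i (by simp [hi, heq, ha.2])) (not_le.2 hlt)

/-- Gauss's lemma: on the antidiagonal of `a + b`, any pair other than `(a, b)` is strictly behind
in one of the factors, so the term of `(a, b)` cannot be cancelled. -/
theorem mul (hρ : 0 < ρ) (hσ : σ ≠ 0) (hg : IsDominant v ρ σ g a) (hh : IsDominant v ρ σ h b) :
    IsDominant v ρ σ (g * h) (a + b) := by
  classical
  have split : ∀ i j, v (g.coeff i * h.coeff j) * ρ ^ (i + j) =
      (v (g.coeff i) * ρ ^ i) * (v (h.coeff j) * ρ ^ j) := by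
    intro i j
    rw [map_mul, pow_add]
    exact mul_mul_mul_comm _ _ _ _
  have hga := hg.pos hρ
  have hhb := hh.pos hρ
  have le_term : ∀ i j, v (g.coeff i * h.coeff j) * ρ ^ (i + j) ≤
      v (g.coeff a * h.coeff b) * ρ ^ (a + b) := by
    intro i j
    rw [split, split]
    exact mul_le_mul' (hg.2 i).1 (hh.2 j).1
  have lt_term : ∀ i j : ℕ, (σ * i < σ * a ∨ σ * j < σ * b) →
      v (g.coeff i * h.coeff j) * ρ ^ (i + j) < v (g.coeff a * h.coeff b) * ρ ^ (a + b) := by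
    intro i j hij
    rw [split, split]
    rcases hij with hi | hj
    · exact ((mul_le_mul' le_rfl (hh.2 j).1).trans_lt (mul_lt_mul_of_pos_right ((hg.2 i).2 hi) hhb))
    · exact ((mul_le_mul' (hg.2 i).1 le_rfl).trans_lt (mul_lt_mul_of_pos_left ((hh.2 j).2 hj) hga))
  have hpow : ∀ k, 0 < ρ ^ k := fun k => pow_pos hρ k
  have hcoeff : v ((g * h).coeff (a + b)) = v (g.coeff a * h.coeff b) := by
    rw [Polynomial.coeff_mul, ← Finset.add_sum_erase _ _
      (show (a, b) ∈ Finset.HasAntidiagonal.antidiagonal (a + b) by simp)]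
    refine v.map_add_eq_of_lt_left (v.map_sum_lt ?_ ?_)
    · exact v.ne_zero_iff.2 (mul_ne_zero hg.1 hh.1)
    · rintro ⟨i, j⟩ hij
      rw [Finset.mem_erase, Finset.HasAntidiagonal.mem_antidiagonal] at hij
      obtain ⟨hne, hij⟩ := hij
      have hijz : (i : ℤ) + j = a + b := by exact_mod_cast hij
      have hlt : σ * i < σ * a ∨ σ * j < σ * b := by
        by_contra! hcon
        have hia : σ * i = σ * a := by
          have : σ * i + σ * j = σ * a + σ * b := by rw [← mul_add, ← mul_add, hijz]
          linarith [hcon.1, hcon.2]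
        have hia' : i = a := by exact_mod_cast mul_left_cancel₀ hσ hia
        exact hne (by rw [Prod.mk.injEq]; omega)
      have := lt_term i j hlt
      simp only at hij
      rw [hij] at this
      exact lt_of_mul_lt_mul_right this (hpow _).le
  refine ⟨fun h0 => ?_, fun k => ?_⟩
  · rw [h0, map_zero] at hcoeff
    exact v.ne_zero_iff.2 (mul_ne_zero hg.1 hh.1) hcoeff.symm
  rw [hcoeff, ← le_div_iff₀ (hpow k), ← lt_div_iff₀ (hpow k), Polynomial.coeff_mul]
  constructor
  · refine v.map_sum_le fun ij hij => ?_
    rw [Finset.HasAntidiagonal.mem_antidiagonal] at hij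
    rw [le_div_iff₀ (hpow k), ← hij]
    exact le_term _ _
  · intro hk
    refine v.map_sum_lt (div_pos ?_ (hpow k)).ne' fun ij hij => ?_
    · rw [split]
      exact mul_pos hga hhb
    · rw [Finset.HasAntidiagonal.mem_antidiagonal] at hij
      rw [lt_div_iff₀ (hpow k), ← hij]
      refine lt_term _ _ ?_
      by_contra! hcon
      rw [← hij] at hk
      push_cast at hk
      linarith [hcon.1, hcon.2]

/-- Convexity of the polygon: enlarging the radius favours higher indices, so the dominant index
cannot decrease. -/
theorem le_of_lt (hρ : 0 < ρ') (hlt : ρ' < ρ) (hg' : IsDominant v ρ' σ' g a')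
    (hg : IsDominant v ρ σ g a) : a' ≤ a := by
  by_contra! hlt'
  obtain ⟨d, rfl⟩ := Nat.exists_eq_add_of_lt hlt'
  have h1 := (hg'.2 a).1
  have h2 := (hg.2 (a + d + 1)).1
  rw [add_assoc, pow_add, ← mul_assoc, mul_right_comm] at h1 h2
  have h1' := le_of_mul_le_mul_right h1 (pow_pos hρ a)
  have h2' := le_of_mul_le_mul_right h2 (pow_pos (hρ.trans hlt) a)
  have hpos : 0 < v (g.coeff (a + (d + 1))) := zero_lt_iff.2 (v.ne_zero_iff.2 hg'.1)
  exact absurd (h2'.trans h1')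
    (not_le.2 (mul_lt_mul_of_pos_left (pow_lt_pow_left₀ hlt hρ.le d.succ_ne_zero) hpos))

/-- A vertex of the Newton polygon of a product at which two sides meet is the sum of such vertices
of the factors. -/
theorem eq_of_mul (hρ : 0 < ρ') (hlt : ρ' < ρ) (hσ : σ ≠ 0) (hσ' : σ' ≠ 0) {c : ℕ}
    (hgh : IsDominant v ρ σ (g * h) c) (hgh' : IsDominant v ρ' σ' (g * h) c)
    (hg : IsDominant v ρ σ g a) (hg' : IsDominant v ρ' σ' g a') : a' = a := by
  have hh0 : h ≠ 0 := by
    rintro rfl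
    exact hgh.1 (by simp)
  obtain ⟨b, hb⟩ := exists_of_ne_zero v (hρ.trans hlt) σ hh0
  obtain ⟨b', hb'⟩ := exists_of_ne_zero v hρ σ' hh0
  -- Both `a + b` and `a' + b'` equal `c`, while `a' ≤ a` and `b' ≤ b`; so both inequalities are
  -- equalities.
  have h1 := hgh.unique hσ (hg.mul (hρ.trans hlt) hσ hb)
  have h2 := hgh'.unique hσ' (hg'.mul hρ hσ' hb')
  have h3 := hg'.le_of_lt hρ hlt hg
  have h4 := hb'.le_of_lt hρ hlt hb
  omega

end IsDominant

/-! ### Digit sums in base `p`. -/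

section DigitSum

variable (p : ℕ)

theorem digits_sum_eq_mod_add (hp : 1 < p) (n : ℕ) :
    (p.digits n).sum = n % p + (p.digits (n / p)).sum := by
  rcases Nat.eq_zero_or_pos n with rfl | hn
  · simp
  · rw [Nat.digits_def' hp hn, List.sum_cons]

theorem digits_sum_eq_div_pow_add (hp : 1 < p) (k n : ℕ) :
    (p.digits n).sum = (p.digits (n / p ^ k)).sum + (p.digits (n % p ^ k)).sum := by
  induction k generalizing n with
  | zero => simp [Nat.mod_one]
  | succ k ih =>
    rw [digits_sum_eq_mod_add p hp n, ih (n / p), digits_sum_eq_mod_add p hp (n % p ^ (k + 1)),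
      Nat.div_div_eq_div_mul, ← pow_succ',
      Nat.mod_mod_of_dvd n (dvd_pow_self p k.succ_ne_zero)]
    have : n % p ^ (k + 1) / p = n / p % p ^ k := by
      rw [pow_succ', Nat.mod_mul_right_div_self]
    rw [this]
    omega

theorem digits_sum_mul_pow (hp : 1 < p) (k q : ℕ) :
    (p.digits (q * p ^ k)).sum = (p.digits q).sum := by
  rw [digits_sum_eq_div_pow_add p hp k, Nat.mul_div_cancel _ (by positivity)]
  simp

/-- By Legendre's formula `q - s(q) = (p - 1) v_p(q!)`, which is monotone in `q`. -/
theorem digits_sum_add_le [Fact p.Prime] (q k : ℕ) :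
    (p.digits (q + k)).sum ≤ (p.digits q).sum + k := by
  have h1 := sub_one_mul_padicValNat_factorial (p := p) q
  have h2 := sub_one_mul_padicValNat_factorial (p := p) (q + k)
  have h3 : padicValNat p q ! ≤ padicValNat p (q + k)! := by
    rw [← padicValNat_dvd_iff_le (Nat.factorial_ne_zero _)]
    exact pow_padicValNat_dvd.trans (Nat.factorial_dvd_factorial (Nat.le_add_right q k))
  have h4 := Nat.mul_le_mul_left (p - 1) h3
  have h5 := Nat.digit_sum_le p q
  have h6 := Nat.digit_sum_le p (q + k)
  omega

/-- The digit of `p ^ n` adds as much to `p ^ n * s(i)` as to `i`, so it drops out; the higher and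
the lower digits then separate. -/
theorem pow_mul_digits_sum_sub (hp : 1 < p) (n i : ℕ) :
    (p : ℤ) ^ n * (p.digits i).sum - i =
      (p : ℤ) ^ n * ((p.digits (i / p ^ (n + 1))).sum - p * ((i / p ^ (n + 1) : ℕ) : ℤ)) +
        ((p : ℤ) ^ n * (p.digits (i % p ^ n)).sum - ((i % p ^ n : ℕ) : ℤ)) := by
  have h1 : i / p ^ (n + 1) = i / p ^ n / p := by rw [pow_succ, Nat.div_div_eq_div_mul]
  rw [digits_sum_eq_div_pow_add p hp n i, digits_sum_eq_mod_add p hp (i / p ^ n), h1]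
  have h2 : ((p ^ n * (i / p ^ n) + i % p ^ n : ℕ) : ℤ) = i := by rw [Nat.div_add_mod]
  have h3 : ((p * (i / p ^ n / p) + i / p ^ n % p : ℕ) : ℤ) = (i / p ^ n : ℕ) := by
    rw [Nat.div_add_mod]
  rw [Nat.cast_add, Nat.cast_mul] at h2 h3
  rw [Nat.cast_pow] at h2
  rw [Nat.cast_add, Nat.cast_add]
  linear_combination (p : ℤ) ^ n * h3 + h2

theorem pow_mul_digits_sum_sub_pos {n e : ℕ} (he : e < p ^ n) (h0 : e ≠ 0) :
    (0 : ℤ) < (p : ℤ) ^ n * (p.digits e).sum - e := by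
  have hS : 0 < (p.digits e).sum := by
    have hnil : p.digits e ≠ [] := Nat.digits_ne_nil_iff_ne_zero.mpr h0
    exact List.sum_pos_iff_exists_pos_nat.mpr
      ⟨_, List.getLast_mem hnil, Nat.pos_of_ne_zero (Nat.getLast_digit_ne_zero p h0)⟩
  have h1 : p ^ n * 1 ≤ p ^ n * (p.digits e).sum := Nat.mul_le_mul_left _ hS
  have h2 : ((p ^ n * (p.digits e).sum : ℕ) : ℤ) = (p : ℤ) ^ n * ((p.digits e).sum : ℤ) := by
    push_cast; ring
  rw [← h2]
  omega

/-- The function `i ↦ p ^ n * s(i) - i`, with `s` the digit sum in base `p`, attains its minimum on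
`i ≤ m` at `i = ⌊m / p ^ k⌋ * p ^ k` for `k = n` and `k = n + 1`. -/
theorem pow_mul_digits_sum_sub_le [Fact p.Prime] {n k m i : ℕ} (hk : k = n ∨ k = n + 1)
    (hi : i ≤ m) :
    (p : ℤ) ^ n * (p.digits (m / p ^ k * p ^ k)).sum - (m / p ^ k * p ^ k : ℕ) ≤
        (p : ℤ) ^ n * (p.digits i).sum - i ∧
      ((i / p ^ (n + 1) < m / p ^ (n + 1) ∨ i % p ^ n ≠ 0) →
        (p : ℤ) ^ n * (p.digits (m / p ^ k * p ^ k)).sum - (m / p ^ k * p ^ k : ℕ) <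
          (p : ℤ) ^ n * (p.digits i).sum - i) := by
  have hp : 1 < p := (Fact.out : p.Prime).one_lt
  have hpos : ∀ l, 0 < p ^ l := fun l => by positivity
  -- The two truncations differ only in the digit of `p ^ n`, so both values of `k` give the same
  -- minimum.
  have hmod : (m / p ^ k * p ^ k) % p ^ n = 0 := by
    rw [← Nat.dvd_iff_mod_eq_zero]
    exact (pow_dvd_pow p (by omega)).mul_left _
  have hdiv : (m / p ^ k * p ^ k) / p ^ (n + 1) = m / p ^ (n + 1) := by
    rcases hk with rfl | rfl
    · rw [pow_succ, ← Nat.div_div_eq_div_mul, Nat.mul_div_cancel _ (hpos _),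
        Nat.div_div_eq_div_mul]
    · exact Nat.mul_div_cancel _ (hpos _)
  rw [pow_mul_digits_sum_sub p hp n (m / p ^ k * p ^ k), pow_mul_digits_sum_sub p hp n i, hmod, hdiv]
  have hq : i / p ^ (n + 1) ≤ m / p ^ (n + 1) := Nat.div_le_div_right hi
  generalize m / p ^ (n + 1) = Q at *
  generalize i / p ^ (n + 1) = q at *
  obtain ⟨d, rfl⟩ := Nat.exists_eq_add_of_le hq
  have hS : ((p.digits (q + d)).sum : ℤ) ≤ (p.digits q).sum + d := by
    exact_mod_cast digits_sum_add_le p q d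
  have hP : (1 : ℤ) ≤ (p : ℤ) ^ n := by exact_mod_cast hpos n
  have hpz : (2 : ℤ) ≤ p := by exact_mod_cast hp
  have hd : (0 : ℤ) ≤ d := by positivity
  -- Raising `q` by `d` costs at most `d` in digit sum and gains `p * d ≥ 2 * d`.
  have hdrop : ((p.digits (q + d)).sum : ℤ) - p * ((q + d : ℕ) : ℤ) ≤
      ((p.digits q).sum - p * (q : ℤ)) - d := by
    rw [Nat.cast_add]
    nlinarith
  have he0 : i % p ^ n ≠ 0 →
      (0 : ℤ) < (p : ℤ) ^ n * (p.digits (i % p ^ n)).sum - ((i % p ^ n : ℕ) : ℤ) :=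
    pow_mul_digits_sum_sub_pos p (Nat.mod_lt _ (hpos n))
  have he1 : (0 : ℤ) ≤ (p : ℤ) ^ n * (p.digits (i % p ^ n)).sum - ((i % p ^ n : ℕ) : ℤ) := by
    by_cases h0 : i % p ^ n = 0
    · simp [h0]
    · exact (he0 h0).le
  generalize (p : ℤ) ^ n * (p.digits (i % p ^ n)).sum - ((i % p ^ n : ℕ) : ℤ) = E at *
  have hmul := mul_le_mul_of_nonneg_left hdrop (zero_le_one.trans hP)
  have hPd := mul_le_mul_of_nonneg_right hP hd
  simp only [Nat.digits_zero, List.sum_nil, Nat.cast_zero, mul_zero, sub_zero, add_zero]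
  constructor
  · linarith
  · rintro (h | h)
    · have : (1 : ℤ) ≤ d := by omega
      linarith
    · linarith [he0 h]

end DigitSum

/-! ### The `p`-adic valuation and the slopes of the exponential series. -/

/-- The `p`-adic absolute value on `ℚ`. -/
noncomputable def padicNNValuation (p : ℕ) [Fact p.Prime] : Valuation ℚ NNReal :=
  (NormedField.valuation (K := ℚ_[p])).comap (algebraMap ℚ ℚ_[p])

/-- At radius `p ^ (-l)`, a dominant term is one that minimizes `v_p(c_j) + j * l`. -/
theorem padicNNValuation_mul_pow (p : ℕ) [Fact p.Prime] {x : ℚ} (hx : x ≠ 0) (l : ℝ) (j : ℕ) :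
    padicNNValuation p x * ((p : NNReal) ^ (-l)) ^ j =
      (p : NNReal) ^ (-(padicValRat p x + j * l)) := by
  have hp : (p : NNReal) ≠ 0 := by exact_mod_cast (Fact.out : p.Prime).ne_zero
  have h1 : padicNNValuation p x = (p : NNReal) ^ (-(padicValRat p x : ℝ)) := by
    apply NNReal.eq
    have h2 : ((padicNNValuation p x : NNReal) : ℝ) = ‖((x : ℚ) : ℚ_[p])‖ := rfl
    rw [h2, Padic.eq_padicNorm, padicNorm.eq_zpow_of_nonzero hx, NNReal.coe_rpow,
      ← Int.cast_neg, Real.rpow_intCast]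
    push_cast
    rfl
  rw [h1, ← NNReal.rpow_natCast, ← NNReal.rpow_mul, ← NNReal.rpow_add hp]
  congr 1
  ring

theorem NNReal.strictMono_rpow_of_one_lt {x : NNReal} (hx : 1 < x) :
    StrictMono fun y : ℝ => x ^ y :=
  fun _ _ h => NNReal.rpow_lt_rpow_of_exponent_lt hx h

/-- The `n`-th slope of the `p`-adic Newton polygon of the exponential series. -/
noncomputable def expSlope (p n : ℕ) : ℝ := ((p : ℝ) ^ n - 1) / ((p : ℝ) ^ n * (p - 1))

theorem expSlope_lt_succ {p : ℕ} (hp : 1 < p) (n : ℕ) : expSlope p n < expSlope p (n + 1) := by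
  have h1 : (1 : ℝ) < p := by exact_mod_cast hp
  have h2 : (0 : ℝ) < (p : ℝ) ^ n := by positivity
  unfold expSlope
  rw [div_lt_div_iff₀ (mul_pos h2 (by linarith)) (mul_pos (by positivity) (by linarith)), pow_succ]
  have h3 : 0 < (p : ℝ) ^ n * ((p : ℝ) - 1) * (p - 1) := by
    have : (0 : ℝ) < p - 1 := by linarith
    positivity
  nlinarith

/-- The radius of slope `expSlope p n`. -/
noncomputable def expRadius (p n : ℕ) : NNReal := (p : NNReal) ^ (-expSlope p n)

theorem expRadius_pos {p : ℕ} (hp : 1 < p) (n : ℕ) : 0 < expRadius p n :=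
  NNReal.rpow_pos (by exact_mod_cast (zero_lt_one.trans hp))

theorem expRadius_succ_lt {p : ℕ} (hp : 1 < p) (n : ℕ) : expRadius p (n + 1) < expRadius p n :=
  NNReal.rpow_lt_rpow_of_exponent_lt (by exact_mod_cast hp) (neg_lt_neg (expSlope_lt_succ hp n))

/-- The horizontal length of a side of slope `expSlope p n` of a Newton polygon over `ℚ` is
divisible by `p ^ n`. -/
theorem IsDominant.dvd_sub {p : ℕ} [Fact p.Prime] {n : ℕ} {σ σ' : ℤ} {g : Polynomial ℚ} {a a' : ℕ}
    (h : IsDominant (padicNNValuation p) (expRadius p n) σ g a)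
    (h' : IsDominant (padicNNValuation p) (expRadius p n) σ' g a') :
    (p : ℤ) ^ n ∣ a - a' := by
  have hp : p.Prime := Fact.out
  have hp1 : (1 : ℝ) < p := by exact_mod_cast hp.one_lt
  have hpn : (p : ℝ) ^ n ≠ 0 := by positivity
  have hps : (p : ℝ) - 1 ≠ 0 := by linarith
  have heq := h.weight_eq h'
  rw [expRadius, padicNNValuation_mul_pow p h.1, padicNNValuation_mul_pow p h'.1] at heq
  have heq2 := neg_injective ((NNReal.rpow_right_inj (by exact_mod_cast hp.ne_zero)
    (by exact_mod_cast hp.one_lt.ne')).1 heq)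
  unfold expSlope at heq2
  field_simp at heq2
  have heq3 : ((a : ℤ) - a') * ((p : ℤ) ^ n - 1) =
      (p : ℤ) ^ n * ((padicValRat p (g.coeff a') - padicValRat p (g.coeff a)) * (p - 1)) := by
    have : (((a : ℤ) - a') * ((p : ℤ) ^ n - 1) : ℝ) =
      (p : ℝ) ^ n * ((padicValRat p (g.coeff a') - padicValRat p (g.coeff a)) * (p - 1)) := by
      push_cast
      linear_combination heq2
    exact_mod_cast this
  -- The numerator `p ^ n - 1` of the slope is prime to `p ^ n`, so `p ^ n` must divide the length
  -- `a - a'`.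
  have hco : IsCoprime ((p : ℤ) ^ n) ((p : ℤ) ^ n - 1) := ⟨1, -1, by ring⟩
  exact hco.dvd_of_dvd_mul_right ⟨_, heq3⟩

/-! ### Laguerre polynomials and Schur's theorem. -/

/-- The polynomial `(-1) ^ m * m! * L_m`, with `L_m` the Laguerre polynomial of degree `m`. -/
noncomputable def monicLaguerre (m : ℕ) : Polynomial ℚ :=
  ∑ j ∈ Finset.range (m + 1),
    Polynomial.C ((-1) ^ (m - j) * (m.choose j) * (m ! / j !) : ℚ) * Polynomial.X ^ j

theorem coeff_monicLaguerre (m j : ℕ) :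
    (monicLaguerre m).coeff j = (-1) ^ (m - j) * (m.choose j) * (m ! / j !) := by
  simp only [monicLaguerre, Polynomial.finsetSum_coeff, Polynomial.coeff_C_mul_X_pow]
  rw [Finset.sum_ite_eq]
  split_ifs with h
  · rfl
  · rw [Finset.mem_range, not_lt] at h
    rw [Nat.choose_eq_zero_of_lt (by omega)]
    simp

theorem coeff_monicLaguerre_ne_zero {m j : ℕ} (hj : j ≤ m) : (monicLaguerre m).coeff j ≠ 0 := by
  rw [coeff_monicLaguerre]
  have h1 : (m.choose j : ℚ) ≠ 0 := by exact_mod_cast (Nat.choose_pos hj).ne'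
  have h2 : (m ! : ℚ) ≠ 0 := by exact_mod_cast m.factorial_ne_zero
  have h3 : (j ! : ℚ) ≠ 0 := by exact_mod_cast j.factorial_ne_zero
  positivity

theorem natDegree_monicLaguerre (m : ℕ) : (monicLaguerre m).natDegree = m := by
  refine Polynomial.natDegree_eq_of_le_of_coeff_ne_zero ?_ (coeff_monicLaguerre_ne_zero le_rfl)
  rw [Polynomial.natDegree_le_iff_coeff_eq_zero]
  intro j hj
  rw [coeff_monicLaguerre, Nat.choose_eq_zero_of_lt hj]
  simp

/-- Legendre's formula for `j!` reduces the weight, up to a constant and a nonnegative binomial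
term, to the function `p ^ n * s(j) - j` already minimized. -/
theorem weight_coeff_monicLaguerre (p : ℕ) [Fact p.Prime] (n : ℕ) {m j : ℕ} (hj : j ≤ m) :
    (p : ℝ) ^ n * (p - 1) * (padicValRat p ((monicLaguerre m).coeff j) + j * expSlope p n) =
      (p : ℝ) ^ n * (p - 1) * padicValNat p m ! +
        (p : ℝ) ^ n * ((p - 1) * padicValNat p (m.choose j)) +
        (((p : ℤ) ^ n * (p.digits j).sum - j : ℤ) : ℝ) := by
  have hp : p.Prime := Fact.out
  have hp1 : (1 : ℝ) < p := by exact_mod_cast hp.one_lt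
  have hpn : (p : ℝ) ^ n ≠ 0 := by positivity
  have hps : (p : ℝ) - 1 ≠ 0 := by linarith
  have h1 : (m.choose j : ℚ) ≠ 0 := by exact_mod_cast (Nat.choose_pos hj).ne'
  have h2 : (m ! : ℚ) ≠ 0 := by exact_mod_cast m.factorial_ne_zero
  have h3 : (j ! : ℚ) ≠ 0 := by exact_mod_cast j.factorial_ne_zero
  have hval : padicValRat p ((monicLaguerre m).coeff j) =
      padicValNat p (m.choose j) + (padicValNat p m ! - padicValNat p j !) := by
    rw [coeff_monicLaguerre, mul_assoc]
    rcases neg_one_pow_eq_or ℚ (m - j) with h | h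
    · rw [h, one_mul, padicValRat.mul h1 (div_ne_zero h2 h3), padicValRat.div h2 h3]
      simp only [padicValRat.of_nat]
    · rw [h, neg_one_mul, padicValRat.neg, padicValRat.mul h1 (div_ne_zero h2 h3),
        padicValRat.div h2 h3]
      simp only [padicValRat.of_nat]
  have hleg : ((p : ℝ) - 1) * padicValNat p j ! = j - (p.digits j).sum := by
    have := sub_one_mul_padicValNat_factorial (p := p) j
    rw [← Nat.cast_pred hp.pos, ← Nat.cast_sub (Nat.digit_sum_le p j), ← this]
    push_cast
    ring
  have hs : (p : ℝ) ^ n * (p - 1) * expSlope p n = (p : ℝ) ^ n - 1 := by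
    unfold expSlope
    field_simp
  rw [hval]
  simp only [Int.cast_sub, Int.cast_add, Int.cast_mul, Int.cast_pow, Int.cast_natCast]
  linear_combination (-(p : ℝ) ^ n) * hleg + j * hs

theorem isDominant_monicLaguerre (p : ℕ) [Fact p.Prime] {n k m : ℕ} {σ : ℤ}
    (hk : k = n ∨ k = n + 1)
    (hσ : ∀ i ≤ m, σ * i < σ * (m / p ^ k * p ^ k : ℕ) →
      i / p ^ (n + 1) < m / p ^ (n + 1) ∨ i % p ^ n ≠ 0) :
    IsDominant (padicNNValuation p) (expRadius p n) σ (monicLaguerre m) (m / p ^ k * p ^ k) := by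
  have hp : p.Prime := Fact.out
  have hp1 : (1 : ℝ) < p := by exact_mod_cast hp.one_lt
  have hc : 0 < (p : ℝ) ^ n * (p - 1) := mul_pos (by positivity) (by linarith)
  have ha : m / p ^ k * p ^ k ≤ m := Nat.div_mul_le_self m _
  -- Kummer: adding `m % p ^ k` to the truncation of `m` produces no carry, so `p` does not divide
  -- this binomial coefficient.
  have hchoose : ((p : ℝ) - 1) * padicValNat p (m.choose (m / p ^ k * p ^ k)) = 0 := by
    have h1 := sub_one_mul_padicValNat_choose_eq_sub_sum_digits (p := p) ha
    have h2 : m - m / p ^ k * p ^ k = m % p ^ k := by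
      have := Nat.div_add_mod' m (p ^ k)
      omega
    rw [h2, digits_sum_mul_pow p hp.one_lt, ← digits_sum_eq_div_pow_add p hp.one_lt,
      Nat.sub_self] at h1
    rw [← Nat.cast_pred hp.pos]
    exact_mod_cast h1
  have hwa := weight_coeff_monicLaguerre p n ha
  rw [hchoose, mul_zero, add_zero] at hwa
  have hP : (1 : NNReal) < p := by exact_mod_cast hp.one_lt
  refine ⟨coeff_monicLaguerre_ne_zero ha, fun i => ?_⟩
  rcases lt_or_ge m i with hi | hi
  · have hz : (monicLaguerre m).coeff i = 0 :=
      Polynomial.coeff_eq_zero_of_natDegree_lt (by rwa [natDegree_monicLaguerre])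
    have hpos : 0 < padicNNValuation p ((monicLaguerre m).coeff (m / p ^ k * p ^ k)) *
        expRadius p n ^ (m / p ^ k * p ^ k) :=
      mul_pos (zero_lt_iff.2 ((padicNNValuation p).ne_zero_iff.2 (coeff_monicLaguerre_ne_zero ha)))
        (pow_pos (expRadius_pos hp.one_lt n) _)
    rw [hz, map_zero, zero_mul]
    exact ⟨hpos.le, fun _ => hpos⟩
  have hwi := weight_coeff_monicLaguerre p n hi
  have hnn : 0 ≤ (p : ℝ) ^ n * ((p - 1) * padicValNat p (m.choose i)) :=
    mul_nonneg (by positivity) (mul_nonneg (by linarith) (by positivity))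
  have hmin := pow_mul_digits_sum_sub_le p hk hi
  rw [expRadius, padicNNValuation_mul_pow p (coeff_monicLaguerre_ne_zero hi),
    padicNNValuation_mul_pow p (coeff_monicLaguerre_ne_zero ha),
    (NNReal.strictMono_rpow_of_one_lt hP).le_iff_le,
    (NNReal.strictMono_rpow_of_one_lt hP).lt_iff_lt, neg_le_neg_iff,
    neg_lt_neg_iff, ← mul_le_mul_iff_right₀ hc, ← mul_lt_mul_iff_right₀ hc, hwa, hwi]
  constructor
  · have := (Int.cast_le (R := ℝ)).2 hmin.1
    linarith
  · intro hlt
    have := (Int.cast_lt (R := ℝ)).2 (hmin.2 (hσ i hi hlt))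
    linarith

/-- This left end at `n` is also the right end at `n + 1`, so it is a vertex to which
`IsDominant.eq_of_mul` applies. -/
theorem isDominant_one_monicLaguerre (p : ℕ) [Fact p.Prime] (n m : ℕ) :
    IsDominant (padicNNValuation p) (expRadius p n) 1 (monicLaguerre m)
      (m / p ^ (n + 1) * p ^ (n + 1)) := by
  have hp : p.Prime := Fact.out
  refine isDominant_monicLaguerre p (Or.inr rfl) fun i _ hlt => Or.inl ?_
  rw [one_mul, one_mul, Int.ofNat_lt] at hlt
  exact (Nat.div_lt_iff_lt_mul (pow_pos hp.pos _)).2 hlt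

theorem isDominant_neg_one_monicLaguerre (p : ℕ) [Fact p.Prime] (n m : ℕ) :
    IsDominant (padicNNValuation p) (expRadius p n) (-1) (monicLaguerre m)
      (m / p ^ n * p ^ n) := by
  refine isDominant_monicLaguerre p (Or.inl rfl) fun i hi hlt => Or.inr fun h0 => ?_
  have h1 : m / p ^ n * p ^ n < i := by
    have : ((m / p ^ n * p ^ n : ℕ) : ℤ) < i := by linarith
    exact_mod_cast this
  have h2 : i = i / p ^ n * p ^ n := by
    have := Nat.div_add_mod' i (p ^ n)
    omega
  have h3 : i / p ^ n * p ^ n ≤ m / p ^ n * p ^ n :=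
    Nat.mul_le_mul_right _ (Nat.div_le_div_right hi)
  omega

/-- For `p ^ r ∣ m`, the polygon of `g` is made of sides with `n ≥ r`, whose lengths are multiples
of `p ^ r`; its right end at `n = r` is the degree of `g`. -/
theorem dvd_natDegree_of_mul_eq_monicLaguerre {m : ℕ} {g h : Polynomial ℚ}
    (hgh : g * h = monicLaguerre m) : m ∣ g.natDegree := by
  have hF0 : monicLaguerre m ≠ 0 := fun h0 =>
    coeff_monicLaguerre_ne_zero (Nat.zero_le m) (by rw [h0, Polynomial.coeff_zero])
  have hg0 : g ≠ 0 := left_ne_zero_of_mul (hgh ▸ hF0)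
  have hh0 : h ≠ 0 := right_ne_zero_of_mul (hgh ▸ hF0)
  have hdeg : g.natDegree + h.natDegree = m := by
    rw [← Polynomial.natDegree_mul hg0 hh0, hgh, natDegree_monicLaguerre]
  refine (Nat.dvd_iff_prime_pow_dvd_dvd _ _).2 fun p r hp hr => ?_
  have : Fact p.Prime := ⟨hp⟩
  have hpos := expRadius_pos hp.one_lt
  -- Downward induction on `n`, with `d` bounding the distance to an index `n > m`. There `p ^ n >
  -- m`, so the right end is `0`; each step adds one side.
  have key : ∀ d n a, r ≤ n → m < n + d →
      IsDominant (padicNNValuation p) (expRadius p n) (-1) g a → p ^ r ∣ a := by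
    intro d
    induction d with
    | zero =>
      intro n a _ hmn ha
      obtain ⟨b, hb⟩ := IsDominant.exists_of_ne_zero (padicNNValuation p) (hpos n) (-1) hh0
      have h1 := ha.mul (hpos n) (by norm_num) hb
      rw [hgh] at h1
      have h2 := h1.unique (by norm_num) (isDominant_neg_one_monicLaguerre p n m)
      rw [Nat.div_eq_of_lt ((show m < n by omega).trans (Nat.lt_pow_self hp.one_lt))] at h2
      have h3 : a = 0 := by omega
      rw [h3]
      exact dvd_zero _
    | succ d ih =>
      intro n a hrn hmn ha
      obtain ⟨a₁, ha₁⟩ := IsDominant.exists_of_ne_zero (padicNNValuation p) (hpos n) 1 hg0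
      obtain ⟨a₂, ha₂⟩ :=
        IsDominant.exists_of_ne_zero (padicNNValuation p) (hpos (n + 1)) (-1) hg0
      have h1 : a₂ = a₁ := IsDominant.eq_of_mul (hpos (n + 1)) (expRadius_succ_lt hp.one_lt n)
        (by norm_num) (by norm_num) (hgh.symm ▸ isDominant_one_monicLaguerre p n m)
        (hgh.symm ▸ isDominant_neg_one_monicLaguerre p (n + 1) m) ha₁ ha₂
      have h2 : p ^ r ∣ a₁ := h1 ▸ ih (n + 1) a₂ (by omega) (by omega) ha₂
      have h3 : (p : ℤ) ^ r ∣ a - a₁ := (pow_dvd_pow _ hrn).trans (ha.dvd_sub ha₁)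
      have h4 : (p : ℤ) ^ r ∣ a₁ := by exact_mod_cast Int.natCast_dvd_natCast.2 h2
      have h5 : (p : ℤ) ^ r ∣ a := by simpa using dvd_add h3 h4
      exact_mod_cast h5
  obtain ⟨a, ha⟩ := IsDominant.exists_of_ne_zero (padicNNValuation p) (hpos r) (-1) hg0
  obtain ⟨b, hb⟩ := IsDominant.exists_of_ne_zero (padicNNValuation p) (hpos r) (-1) hh0
  have h1 := ha.mul (hpos r) (by norm_num) hb
  rw [hgh] at h1
  have h2 := h1.unique (by norm_num) (isDominant_neg_one_monicLaguerre p r m)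
  -- As `p ^ r ∣ m`, the right end for the product is `m` itself, which forces the right ends of `g`
  -- and `h` to be their degrees.
  rw [Nat.div_mul_cancel hr] at h2
  have h3 := Polynomial.le_natDegree_of_ne_zero ha.1
  have h4 := Polynomial.le_natDegree_of_ne_zero hb.1
  have h5 : g.natDegree = a := by omega
  rw [h5]
  exact key (m + 1) r a le_rfl (by omega) ha

/-- **Schur**: a Laguerre polynomial has no factorization into nonconstant factors over `ℚ`. -/
theorem natDegree_eq_zero_or_of_mul_eq_monicLaguerre {m : ℕ} {g h : Polynomial ℚ}
    (hgh : g * h = monicLaguerre m) : g.natDegree = 0 ∨ h.natDegree = 0 := by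
  have hF0 : monicLaguerre m ≠ 0 := fun h0 =>
    coeff_monicLaguerre_ne_zero (Nat.zero_le m) (by rw [h0, Polynomial.coeff_zero])
  have hdeg : g.natDegree + h.natDegree = m := by
    rw [← Polynomial.natDegree_mul (left_ne_zero_of_mul (hgh ▸ hF0))
      (right_ne_zero_of_mul (hgh ▸ hF0)), hgh, natDegree_monicLaguerre]
  rcases Nat.eq_zero_or_pos g.natDegree with h0 | h0
  · exact Or.inl h0
  · have := Nat.le_of_dvd h0 (dvd_natDegree_of_mul_eq_monicLaguerre hgh)
    omega

/-! ### Irreducibility in two variables. -/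

/-- The polynomial `F(ξ z)` for `F = monicLaguerre m`. -/
noncomputable def laguerreXiZ (m : ℕ) : MvPolynomial (Fin 1 ⊕ Fin 1) ℚ :=
  Polynomial.aeval (X (Sum.inl 0) * X (Sum.inr 0)) (monicLaguerre m)

/-- The identification of `ℚ[ξ, z]` with `ℚ[z][ξ]`. -/
noncomputable def xiZEquiv : MvPolynomial (Fin 1 ⊕ Fin 1) ℚ ≃+* Polynomial (Polynomial ℚ) :=
  ((MvPolynomial.sumRingEquiv ℚ (Fin 1) (Fin 1)).trans
    (MvPolynomial.uniqueAlgEquiv (MvPolynomial (Fin 1) ℚ) (Fin 1)).toRingEquiv).trans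
    (Polynomial.mapEquiv (MvPolynomial.uniqueAlgEquiv ℚ (Fin 1)).toRingEquiv)

theorem xiZEquiv_X_inl : xiZEquiv (X (Sum.inl 0)) = Polynomial.X := by
  simp [xiZEquiv, MvPolynomial.sumRingEquiv_X_inl]

theorem xiZEquiv_X_inr : xiZEquiv (X (Sum.inr 0)) = Polynomial.C Polynomial.X := by
  simp [xiZEquiv, MvPolynomial.sumRingEquiv_X_inr]

theorem xiZEquiv_laguerreXiZ (m : ℕ) : xiZEquiv (laguerreXiZ m) =
    ((monicLaguerre m).map Polynomial.C).comp (Polynomial.C Polynomial.X * Polynomial.X) := by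
  have hX : xiZEquiv (X (Sum.inl 0) * X (Sum.inr 0)) = Polynomial.C Polynomial.X * Polynomial.X := by
    rw [map_mul, xiZEquiv_X_inl, xiZEquiv_X_inr, mul_comm]
  rw [laguerreXiZ, Polynomial.aeval_def, ← RingEquiv.coe_toRingHom, Polynomial.hom_eval₂,
    RingEquiv.coe_toRingHom, hX, Polynomial.comp, Polynomial.eval₂_map]
  exact congrArg (fun f => Polynomial.eval₂ f _ _) (Subsingleton.elim _ _)

theorem coeff_xiZEquiv_laguerreXiZ (m j : ℕ) : (xiZEquiv (laguerreXiZ m)).coeff j =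
    Polynomial.C ((monicLaguerre m).coeff j) * Polynomial.X ^ j := by
  rw [xiZEquiv_laguerreXiZ, Polynomial.comp_C_mul_X_coeff, Polynomial.coeff_map]

/-- A divisor of a polynomial over a domain, whose constant coefficient is a unit, is a unit if it
has degree zero. -/
theorem isUnit_of_mul_of_natDegree_eq_zero {R : Type*} [CommRing R] {G H : Polynomial R}
    (h0 : IsUnit ((G * H).coeff 0)) (hG : G.natDegree = 0) : IsUnit G := by
  rw [Polynomial.eq_C_of_natDegree_eq_zero hG]
  rw [Polynomial.mul_coeff_zero] at h0
  exact (isUnit_of_mul_isUnit_left h0).map Polynomial.C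

theorem irreducible_laguerreXiZ {m : ℕ} (hm : m ≠ 0) : Irreducible (laguerreXiZ m) := by
  rw [← MulEquiv.irreducible_iff xiZEquiv]
  set P := xiZEquiv (laguerreXiZ m) with hP
  have hcoeff : ∀ j, P.coeff j = Polynomial.C ((monicLaguerre m).coeff j) * Polynomial.X ^ j :=
    coeff_xiZEquiv_laguerreXiZ m
  have hunit : IsUnit (P.coeff 0) := by
    rw [hcoeff, pow_zero, mul_one]
    exact (coeff_monicLaguerre_ne_zero (Nat.zero_le m)).isUnit.map Polynomial.C
  have hdeg : P.natDegree = m := by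
    refine Polynomial.natDegree_eq_of_le_of_coeff_ne_zero ?_ ?_
    · rw [Polynomial.natDegree_le_iff_coeff_eq_zero]
      intro j hj
      rw [hcoeff, Polynomial.coeff_eq_zero_of_natDegree_lt (by rwa [natDegree_monicLaguerre])]
      simp
    · rw [hcoeff]
      exact mul_ne_zero (Polynomial.C_ne_zero.2 (coeff_monicLaguerre_ne_zero le_rfl))
        (pow_ne_zero _ Polynomial.X_ne_zero)
  have hP0 : P ≠ 0 := by
    intro h
    rw [h, Polynomial.natDegree_zero] at hdeg
    exact hm hdeg.symm
  -- Specialization at `z = 1`. It preserves the `ξ`-degrees of `G` and `H`: neither can grow, and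
  -- both before and after they account for the full degree `m`.
  have hspec : P.map (Polynomial.evalRingHom 1) = monicLaguerre m := by
    ext j
    rw [Polynomial.coeff_map, hcoeff]
    simp
  refine ⟨fun h => hm ?_, fun G H hGH => ?_⟩
  · rw [← hdeg]
    exact Polynomial.natDegree_eq_zero_of_isUnit h
  have hadd : G.natDegree + H.natDegree = m := by
    rw [← Polynomial.natDegree_mul (left_ne_zero_of_mul (hGH ▸ hP0))
      (right_ne_zero_of_mul (hGH ▸ hP0)), ← hGH, hdeg]
  have hmul : G.map (Polynomial.evalRingHom 1) * H.map (Polynomial.evalRingHom 1) =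
      monicLaguerre m := by
    rw [← Polynomial.map_mul, ← hGH, hspec]
  have hle : m ≤ (G.map (Polynomial.evalRingHom (1 : ℚ))).natDegree +
      (H.map (Polynomial.evalRingHom (1 : ℚ))).natDegree := by
    rw [← natDegree_monicLaguerre m, ← hmul]
    exact Polynomial.natDegree_mul_le
  have hG := Polynomial.natDegree_map_le (f := Polynomial.evalRingHom (1 : ℚ)) (p := G)
  have hH := Polynomial.natDegree_map_le (f := Polynomial.evalRingHom (1 : ℚ)) (p := H)
  rcases natDegree_eq_zero_or_of_mul_eq_monicLaguerre hmul with h | h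
  · exact Or.inl (isUnit_of_mul_of_natDegree_eq_zero (hGH ▸ hunit) (by omega))
  · exact Or.inr (isUnit_of_mul_of_natDegree_eq_zero (mul_comm G H ▸ hGH ▸ hunit) (by omega))

/-! ### Computation of the star product. -/

theorem starOmega_one_pow_tmul (a b k : ℕ) :
    (starOmega 1 ^ k) ((X (Sum.inl 0) ^ a : XiZPoly 1) ⊗ₜ[ℂ] (X (Sum.inr 0) ^ b : XiZPoly 1)) =
      ((a.descFactorial k * b.descFactorial k : ℕ) : ℂ) •
        ((X (Sum.inl 0) ^ (a - k) : XiZPoly 1) ⊗ₜ[ℂ] (X (Sum.inr 0) ^ (b - k) : XiZPoly 1)) := by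
  induction k with
  | zero => simp
  | succ k ih =>
    have hstep : ∀ c d : ℕ, starOmega 1
        ((X (Sum.inl 0) ^ c : XiZPoly 1) ⊗ₜ[ℂ] (X (Sum.inr 0) ^ d : XiZPoly 1)) =
        ((c * d : ℕ) : ℂ) •
          ((X (Sum.inl 0) ^ (c - 1) : XiZPoly 1) ⊗ₜ[ℂ] (X (Sum.inr 0) ^ (d - 1) : XiZPoly 1)) := by
      intro c d
      -- The summand `∂_z ⊗ ∂_ξ` vanishes since `ξ ^ c` does not involve `z`.
      have hz : dZ (0 : Fin 1) (X (Sum.inl 0) ^ c : XiZPoly 1) = 0 := by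
        simp [dZ, Derivation.leibniz_pow, pderiv_X]
      have hx : dXi (0 : Fin 1) (X (Sum.inl 0) ^ c : XiZPoly 1) =
          (c : ℂ) • (X (Sum.inl 0) ^ (c - 1) : XiZPoly 1) := by
        simp [dXi, Derivation.leibniz_pow, Nat.cast_smul_eq_nsmul]
      have hz' : dZ (0 : Fin 1) (X (Sum.inr 0) ^ d : XiZPoly 1) =
          (d : ℂ) • (X (Sum.inr 0) ^ (d - 1) : XiZPoly 1) := by
        simp [dZ, Derivation.leibniz_pow, Nat.cast_smul_eq_nsmul]
      rw [starOmega, Fin.sum_univ_one, LinearMap.add_apply, TensorProduct.map_tmul,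
        TensorProduct.map_tmul, hz, hx, hz', TensorProduct.zero_tmul, zero_add,
        TensorProduct.smul_tmul_smul, Nat.cast_mul]
    rw [pow_succ', Module.End.mul_apply, ih, map_smul, hstep, smul_smul, Nat.sub_sub, Nat.sub_sub,
      Nat.descFactorial_succ, Nat.descFactorial_succ]
    congr 1
    push_cast
    ring

theorem starProd_one_X_pow_X_pow (m : ℕ) :
    starProd (n := 1) 1 (X (Sum.inl 0) ^ m) (X (Sum.inr 0) ^ m) =
      ∑ k ∈ Finset.range (m + 1), C ((k ! : ℂ)⁻¹ * ((-1) ^ k * (m.descFactorial k) ^ 2)) *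
        (X (Sum.inl 0) * X (Sum.inr 0)) ^ (m - k) := by
  have hterm : ∀ k, ((k ! : ℂ)⁻¹) • (((-1 : ℂ) • starOmega 1) ^ k)
      ((X (Sum.inl 0) ^ m : XiZPoly 1) ⊗ₜ[ℂ] (X (Sum.inr 0) ^ m : XiZPoly 1)) =
      ((k ! : ℂ)⁻¹ * ((-1) ^ k * (m.descFactorial k) ^ 2)) •
        ((X (Sum.inl 0) ^ (m - k) : XiZPoly 1) ⊗ₜ[ℂ] (X (Sum.inr 0) ^ (m - k) : XiZPoly 1)) := by
    intro k
    rw [smul_pow, LinearMap.smul_apply, starOmega_one_pow_tmul, smul_smul, smul_smul]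
    congr 1
    push_cast
    ring
  have hsupp : Function.support (fun k : ℕ => ((k ! : ℂ)⁻¹) • (((-1 : ℂ) • starOmega 1) ^ k)
      ((X (Sum.inl 0) ^ m : XiZPoly 1) ⊗ₜ[ℂ] (X (Sum.inr 0) ^ m : XiZPoly 1))) ⊆
      Finset.range (m + 1) := by
    intro k hk
    rw [Function.mem_support, hterm] at hk
    by_contra hcon
    rw [Finset.mem_coe, Finset.mem_range, not_lt] at hcon
    rw [Nat.descFactorial_of_lt hcon] at hk
    simp at hk
  rw [starProd, locNilExp, finsum_eq_sum_of_support_subset _ hsupp, map_sum]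
  refine Finset.sum_congr rfl fun k _ => ?_
  rw [hterm, map_smul, LinearMap.mul'_apply, ← mul_pow, smul_eq_C_mul]

theorem map_laguerreXiZ (m : ℕ) : MvPolynomial.map (algebraMap ℚ ℂ) (laguerreXiZ m) =
    starProd (n := 1) 1 (X (Sum.inl 0) ^ m) (X (Sum.inr 0) ^ m) := by
  -- Reindexing by `j = m - k` matches the order of differentiation with the remaining power of
  -- `ξz`.
  rw [starProd_one_X_pow_X_pow, ← Finset.sum_range_reflect, laguerreXiZ, monicLaguerre, map_sum,
    map_sum]
  refine Finset.sum_congr rfl fun j hj => ?_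
  have hj' : j ≤ m := Nat.lt_succ_iff.1 (Finset.mem_range.1 hj)
  have h1 : m + 1 - 1 - j = m - j := by omega
  rw [h1, Nat.sub_sub_self hj', map_mul, map_pow, Polynomial.aeval_X, Polynomial.aeval_C,
    MvPolynomial.algebraMap_eq, map_mul, map_C, map_pow,
    map_mul (MvPolynomial.map (algebraMap ℚ ℂ)), map_X, map_X]
  congr 2
  have h2 : ((m.descFactorial (m - j) : ℕ) : ℂ) = m ! / j ! := by
    have := Nat.factorial_mul_descFactorial (Nat.sub_le m j)
    rw [Nat.sub_sub_self hj'] at this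
    rw [eq_div_iff (by exact_mod_cast j.factorial_ne_zero), mul_comm]
    exact_mod_cast this
  have h3 : (m.choose j : ℂ) = m ! / (j ! * (m - j)!) := Nat.cast_choose ℂ hj'
  rw [h2]
  simp only [map_mul, map_pow, map_neg, map_one, map_div₀, map_natCast, h3]
  have hj0 : (j ! : ℂ) ≠ 0 := by exact_mod_cast j.factorial_ne_zero
  have hk0 : ((m - j)! : ℂ) ≠ 0 := by exact_mod_cast (m - j).factorial_ne_zero
  field_simp

/-- `ξ^m ∗ z^m` (with `∗ = ∗₁` and `n = 1`) has rational coefficients, and it is irreducible as an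
element of `ℚ[ξ, z]`. -/
theorem theorem5p6 (m : ℕ) (hm : 2 ≤ m) :
    ∃ P : MvPolynomial (Fin 1 ⊕ Fin 1) ℚ,
      MvPolynomial.map (algebraMap ℚ ℂ) P =
        starProd (n := 1) 1 (MvPolynomial.X (Sum.inl 0) ^ m) (MvPolynomial.X (Sum.inr 0) ^ m) ∧
      Irreducible P :=
  ⟨laguerreXiZ m, map_laguerreXiZ m, irreducible_laguerreXiZ (by omega)⟩
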